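/- All spaces and algebras are complex. Let $A$ be a Banach algebra (not assumed unital), with canonical embedding $A\subseteq A^{**}$. For $f\in A^*$, $a,b\in A$ and $F,G\in A^{**}$ put $(f\cdot a)(b)=f(ab)$, $(a\cdot f)(b)=f(ba)$, $(G\cdot f)(a)=G(f\cdot a)$, $(f\cdot F)(a)=F(a\cdot f)$. The first and second Arens products on $A^{**}$ are $(F\,\square\,G)(f)=F(G\cdot f)$ and $(F\,\lozenge\,G)(f)=G(f\cdot F)$; $A$ is Arens regular if they coincide, and then $A^{**}$, with this product, is a dual Banach algebra with predual $A^*$. For a Banach algebra $B$, the dual $X^*$ of a Banach $B$-bimodule $X$ is a Banach $B$-bimodule by $(b\cdot f)(x)=f(x\cdot b)$ and $(f\cdot b)(x)=f(b\cdot x)$. A derivation from $B$ into a Banach $B$-bimodule $Z$ is a bounded linear map $D:B\to Z$ with $D(ab)=D(a)\cdot b+a\cdot D(b)$; it is inner if there is $z\in Z$ with $D(a)=a\cdot z-z\cdot a$ for all $a\in B$. The algebra $B$ is amenable if, for every Banach $B$-bimodule $X$, every derivation from $B$ into $X^*$ is inner. If $B$ is a dual Banach algebra with a given predual, then a dual Banach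 $B$-bimodule $Y^*$ (the dual of a Banach $B$-bimodule $Y$) is normal if for every $\varphi\in Y^*$ the maps $b\mapsto b\cdot\varphi$ and $b\mapsto\varphi\cdot b$ are weak*-weak* continuous from $B$ to $Y^*$, and $B$ is Connes amenable if every weak*-weak* continuous derivation from $B$ into a normal dual Banach $B$-bimodule is inner. A Banach $B$-bimodule $X$ is neo-unital if every $x\in X$ is of the form $x=b\cdot y\cdot c$ with $b,c\in B$ and $y\in X$. **Theorem 1.3.** Let $A$ be an Arens regular Banach algebra with a bounded (two-sided) approximate identity, and suppose that $A$ is a right ideal of $A^{**}$, that is, $aF\in A$ for all $a\in A$ and $F\in A^{**}$. Suppose that for every neo-unital Banach $A^{**}$-bimodule $X$ one has $A\cdot X^*=X^*$, that is, every $f\in X^*$ is of the form $f=a\cdot g$ with $a\in A$ and $g\in X^*$. If $A^{**}$ is Connes amenable, then $A$ is amenable. -/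

import Mathlib

open Filter Topology

universe u

/-! ### Banach bimodules, dual bimodules, derivations -/

/-- A Banach `A`-bimodule structure on `X`: two jointly bounded bilinear actions
`left a x = a · x` and `right a x = x · a` with the usual compatibility laws. -/
structure BanachBimodule (A X : Type u) [NonUnitalNormedRing A] [NormedSpace ℂ A]
    [NormedAddCommGroup X] [NormedSpace ℂ X] where
  left : A →L[ℂ] X →L[ℂ] X
  right : A →L[ℂ] X →L[ℂ] X
  left_mul : ∀ a b x, left (a * b) x = left a (left b x)
  right_mul : ∀ a b x, right (a * b) x = right b (right a x)
  left_right : ∀ a b x, right b (left a x) = left a (right b x)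

namespace BanachBimodule

variable {A X : Type u} [NonUnitalNormedRing A] [NormedSpace ℂ A]
  [NormedAddCommGroup X] [NormedSpace ℂ X]

/-- The dual bimodule `X*`: `(a · f)(x) = f (x · a)` and `(f · a)(x) = f (a · x)`. -/
noncomputable def dual (M : BanachBimodule A X) : BanachBimodule A (StrongDual ℂ X) where
  left := (ContinuousLinearMap.compL ℂ X X ℂ).flip.comp M.right
  right := (ContinuousLinearMap.compL ℂ X X ℂ).flip.comp M.left
  left_mul a b f := by ext x; simp [M.right_mul]
  right_mul a b f := by ext x; simp [M.left_mul]
  left_right a b f := by ext x; simp [M.left_right]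

theorem dual_left_apply (M : BanachBimodule A X) (a : A) (f : StrongDual ℂ X) (x : X) :
    M.dual.left a f x = f (M.right a x) := rfl

theorem dual_right_apply (M : BanachBimodule A X) (a : A) (f : StrongDual ℂ X) (x : X) :
    M.dual.right a f x = f (M.left a x) := rfl

/-- `X` is neo-unital: `X = A · X · A`, i.e. every `x` is of the form `a · y · b`. -/
def NeoUnital (M : BanachBimodule A X) : Prop :=
  ∀ x : X, ∃ (a b : A) (y : X), x = M.left a (M.right b y)

/-- A (bounded) derivation: `D (a b) = D a · b + a · D b`. -/
def IsDerivation (M : BanachBimodule A X) (D : A →L[ℂ] X) : Prop :=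
  ∀ a b : A, D (a * b) = M.right b (D a) + M.left a (D b)

/-- `D` is inner: for some `x`, `D a = a · x - x · a` for all `a`. -/
def IsInner (M : BanachBimodule A X) (D : A →L[ℂ] X) : Prop :=
  ∃ x : X, ∀ a : A, D a = M.left a x - M.right a x

end BanachBimodule

/-! ### Amenability and Connes amenability -/

/-- `A` is amenable: every bounded derivation from `A` into the dual of a Banach `A`-bimodule
is inner. -/
def IsAmenable (A : Type u) [NonUnitalNormedRing A] [NormedSpace ℂ A] : Prop :=
  ∀ (X : Type u) [NormedAddCommGroup X] [NormedSpace ℂ X] [CompleteSpace X]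
    (M : BanachBimodule A X) (D : A →L[ℂ] StrongDual ℂ X),
    M.dual.IsDerivation D → M.dual.IsInner D

section ConnesAmenable

variable {B P : Type u} [NonUnitalNormedRing B] [NormedSpace ℂ B]
  [NormedAddCommGroup P] [NormedSpace ℂ P]

/-- Weak*-weak* continuity of a map from `B = P*` (identified through `e`) to `Y*`. -/
def WeakStarContinuous (e : B ≃ₗᵢ[ℂ] StrongDual ℂ P) {Y : Type u} [NormedAddCommGroup Y]
    [NormedSpace ℂ Y] (T : B → StrongDual ℂ Y) : Prop :=
  Continuous fun w : WeakDual ℂ P =>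
    StrongDual.toWeakDual (T (e.symm (WeakDual.toStrongDual w)))

/-- The dual bimodule `Y*` is normal: for each `φ` in `Y*` the maps `b ↦ b · φ` and
`b ↦ φ · b` are weak*-weak* continuous. -/
def IsNormalDual (e : B ≃ₗᵢ[ℂ] StrongDual ℂ P) {Y : Type u} [NormedAddCommGroup Y]
    [NormedSpace ℂ Y] (M : BanachBimodule B Y) : Prop :=
  ∀ φ : StrongDual ℂ Y, WeakStarContinuous e (fun b => M.dual.left b φ) ∧
    WeakStarContinuous e (fun b => M.dual.right b φ)

/-- The dual Banach algebra `B` with predual `P` (via `e : B ≃ P*`) is Connes amenable: every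
weak*-weak* continuous derivation from `B` into a normal dual Banach `B`-bimodule is inner. -/
def IsConnesAmenable (e : B ≃ₗᵢ[ℂ] StrongDual ℂ P) : Prop :=
  ∀ (Y : Type u) [NormedAddCommGroup Y] [NormedSpace ℂ Y] [CompleteSpace Y]
    (M : BanachBimodule B Y), IsNormalDual e M →
    ∀ D : B →L[ℂ] StrongDual ℂ Y, WeakStarContinuous e D →
      M.dual.IsDerivation D → M.dual.IsInner D

end ConnesAmenable

/-! ### The second dual with the Arens products -/

/-- The second dual `A**`. -/
abbrev Bidual (A : Type u) [NonUnitalNormedRing A] [NormedSpace ℂ A] : Type u :=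
  StrongDual ℂ (StrongDual ℂ A)

section Arens

variable {A : Type u} [NonUnitalNormedRing A] [NormedSpace ℂ A] [IsScalarTower ℂ A A]
  [SMulCommClass ℂ A A]

/-- `G · f` in `A*`: `(G · f)(a) = G (f · a)`, where `(f · a)(b) = f (a b)`. -/
noncomputable def arensLeft (G : Bidual A) (f : StrongDual ℂ A) : StrongDual ℂ A :=
  G.comp ((ContinuousLinearMap.compL ℂ A A ℂ f).comp (ContinuousLinearMap.mul ℂ A))

/-- `f · F` in `A*`: `(f · F)(a) = F (a · f)`, where `(a · f)(b) = f (b a)`. -/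
noncomputable def arensRight (f : StrongDual ℂ A) (F : Bidual A) : StrongDual ℂ A :=
  F.comp ((ContinuousLinearMap.compL ℂ A A ℂ f).comp (ContinuousLinearMap.mul ℂ A).flip)

theorem arensLeft_apply (G : Bidual A) (f : StrongDual ℂ A) (a : A) :
    arensLeft G f a = G (f.comp (ContinuousLinearMap.mul ℂ A a)) := rfl

theorem arensRight_apply (f : StrongDual ℂ A) (F : Bidual A) (a : A) :
    arensRight f F a = F (f.comp ((ContinuousLinearMap.mul ℂ A).flip a)) := rfl

theorem norm_arensLeft_le (G : Bidual A) (f : StrongDual ℂ A) :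
    ‖arensLeft G f‖ ≤ ‖G‖ * ‖f‖ := by
  refine ContinuousLinearMap.opNorm_le_bound _ (by positivity) fun a => ?_
  rw [arensLeft_apply]
  calc ‖G (f.comp (ContinuousLinearMap.mul ℂ A a))‖
      ≤ ‖G‖ * ‖f.comp (ContinuousLinearMap.mul ℂ A a)‖ := G.le_opNorm _
    _ ≤ ‖G‖ * (‖f‖ * ‖a‖) := by
        gcongr
        exact (f.opNorm_comp_le _).trans
          (by gcongr; exact ContinuousLinearMap.opNorm_mul_apply_le ℂ A a)
    _ = ‖G‖ * ‖f‖ * ‖a‖ := by ring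

theorem norm_arensRight_le (f : StrongDual ℂ A) (F : Bidual A) :
    ‖arensRight f F‖ ≤ ‖F‖ * ‖f‖ := by
  refine ContinuousLinearMap.opNorm_le_bound _ (by positivity) fun a => ?_
  rw [arensRight_apply]
  calc ‖F (f.comp ((ContinuousLinearMap.mul ℂ A).flip a))‖
      ≤ ‖F‖ * ‖f.comp ((ContinuousLinearMap.mul ℂ A).flip a)‖ := F.le_opNorm _
    _ ≤ ‖F‖ * (‖f‖ * ‖a‖) := by
        gcongr
        refine (f.opNorm_comp_le _).trans ?_
        gcongr
        refine ContinuousLinearMap.opNorm_le_bound _ (by positivity) fun b => ?_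
        simpa [mul_comm] using norm_mul_le b a
    _ = ‖F‖ * ‖f‖ * ‖a‖ := by ring

/-- The first Arens product: `(F □ G)(f) = F (G · f)`. -/
noncomputable def firstArens (F G : Bidual A) : Bidual A :=
  LinearMap.mkContinuous
    { toFun := fun f => F (arensLeft G f)
      map_add' := fun f g => by
        rw [← map_add]; congr 1; ext a; simp [arensLeft_apply, ContinuousLinearMap.add_comp]
      map_smul' := fun c f => by
        rw [← map_smul]; congr 1; ext a; simp [arensLeft_apply, ContinuousLinearMap.smul_comp] }
    (‖F‖ * ‖G‖) fun f => by
      refine (F.le_opNorm _).trans ?_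
      rw [mul_assoc]
      gcongr
      exact norm_arensLeft_le G f

/-- The second Arens product: `(F ◇ G)(f) = G (f · F)`. -/
noncomputable def secondArens (F G : Bidual A) : Bidual A :=
  LinearMap.mkContinuous
    { toFun := fun f => G (arensRight f F)
      map_add' := fun f g => by
        rw [← map_add]; congr 1; ext a; simp [arensRight_apply, ContinuousLinearMap.add_comp]
      map_smul' := fun c f => by
        rw [← map_smul]; congr 1; ext a; simp [arensRight_apply, ContinuousLinearMap.smul_comp] }
    (‖G‖ * ‖F‖) fun f => by
      refine (G.le_opNorm _).trans ?_
      rw [mul_assoc]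
      gcongr
      exact norm_arensRight_le f F

theorem firstArens_apply (F G : Bidual A) (f : StrongDual ℂ A) :
    firstArens F G f = F (arensLeft G f) := rfl

theorem secondArens_apply (F G : Bidual A) (f : StrongDual ℂ A) :
    secondArens F G f = G (arensRight f F) := rfl

theorem norm_firstArens_le (F G : Bidual A) : ‖firstArens F G‖ ≤ ‖F‖ * ‖G‖ :=
  LinearMap.mkContinuous_norm_le _ (mul_nonneg (norm_nonneg F) (norm_nonneg G)) _

/-- `A**` is a normed algebra (and a Banach algebra) under the first Arens product. -/
noncomputable instance Bidual.instNonUnitalNormedRing : NonUnitalNormedRing (Bidual A) :=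
  { (inferInstance : NormedAddCommGroup (StrongDual ℂ (StrongDual ℂ A))) with
    mul := firstArens
    left_distrib := fun F G H => by
      ext f
      change F (arensLeft (G + H) f) = F (arensLeft G f) + F (arensLeft H f)
      rw [← map_add]; rfl
    right_distrib := fun F G H => rfl
    zero_mul := fun F => rfl
    mul_zero := fun F => by
      ext f
      change F (arensLeft 0 f) = 0
      rw [show arensLeft (0 : Bidual A) f = 0 from rfl, map_zero]
    mul_assoc := fun F G H => by
      ext f
      change F (arensLeft G (arensLeft H f)) = F (arensLeft (firstArens G H) f)
      congr 1
      ext a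
      change G _ = G _
      congr 1
      ext b
      change H _ = H _
      congr 1
      ext c
      simp [mul_assoc]
    norm_mul_le := fun F G => norm_firstArens_le F G }

theorem Bidual.mul_def (F G : Bidual A) : F * G = firstArens F G := rfl

end Arens

section ArensHyp

variable (A : Type u) [NonUnitalNormedRing A] [NormedSpace ℂ A] [IsScalarTower ℂ A A]
  [SMulCommClass ℂ A A]

/-- `A` is Arens regular: the two Arens products on `A**` coincide. -/
def IsArensRegular : Prop :=
  ∀ F G : Bidual A, firstArens F G = secondArens F G

/-- `A`, canonically embedded in `A**`, is a right ideal of `A**`: `A · A** ⊆ A`. -/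
def IsRightIdealInBidual : Prop :=
  ∀ (a : A) (F : Bidual A), ∃ b : A,
    (NormedSpace.inclusionInDoubleDual ℂ A a : Bidual A) * F =
      NormedSpace.inclusionInDoubleDual ℂ A b

/-- `A` has a bounded (two-sided) approximate identity. -/
def HasBoundedApproximateIdentity : Prop :=
  ∃ l : Filter A, l.IsApproximateUnit ∧ ∃ C : ℝ, ∀ᶠ x in l, ‖x‖ ≤ C

/-- For every neo-unital Banach `A**`-bimodule `X`, `X* = A · X*`: every `f` in `X*` is of the
form `a · g` with `a` in `A` and `g` in `X*`. -/
def NeoUnitalDualsFactor : Prop :=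
  ∀ (X : Type u) [NormedAddCommGroup X] [NormedSpace ℂ X] [CompleteSpace X]
    (M : BanachBimodule (Bidual A) X), M.NeoUnital →
    ∀ f : StrongDual ℂ X, ∃ (a : A) (g : StrongDual ℂ X),
      f = M.dual.left (NormedSpace.inclusionInDoubleDual ℂ A a) g

end ArensHyp

/-! ### The bimodule $A^*$ over $A^{**}$, and reflexivity of $A$ -/

section BidualModule

open NormedSpace

variable {A : Type u} [NonUnitalNormedRing A] [NormedSpace ℂ A] [IsScalarTower ℂ A A]
  [SMulCommClass ℂ A A]

/-! The hypotheses force $A$ to be reflexive. By Arens regularity $A^*$ is an $A^{**}$-bimodule, and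
it is neo-unital because a weak* cluster point of the approximate identity acts on it as a unit. Its
dual is $A^{**}$, on which $A$ acts by left multiplication, so factorization for this single
bimodule reads $A^{**} = A \cdot A^{**}$, and the right ideal condition puts this inside $A$. For
reflexive $A$, weak* continuity of bounded maps on $A^{**}$ into dual spaces is automatic, so Connes
amenability of $A^{**} = A$ is amenability. -/

theorem inclusionInDoubleDual_mul (a b : A) :
    (inclusionInDoubleDual ℂ A (a * b) : Bidual A) =
      (inclusionInDoubleDual ℂ A a : Bidual A) * inclusionInDoubleDual ℂ A b := rfl

theorem arensLeft_mul (F G : Bidual A) (f : StrongDual ℂ A) :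
    arensLeft (F * G) f = arensLeft F (arensLeft G f) := by
  ext a
  change F _ = F _
  congr 1
  ext b
  change G _ = G _
  congr 1
  ext c
  simp [mul_assoc]

/-- The right action is compatible with $\lozenge$, as the left action is with $\square$; neither
fact needs regularity. -/
theorem arensRight_secondArens (F G : Bidual A) (f : StrongDual ℂ A) :
    arensRight f (secondArens F G) = arensRight (arensRight f F) G := by
  ext a
  change G _ = G _
  congr 1
  ext b
  change F _ = F _
  congr 1
  ext c
  simp [mul_assoc]

/-- The two actions of `A**` on `A*` commute when `A` is Arens regular: at `a`, the two sides are
the values at `f` of the triple products `F (a G)` and `(F a) G`. -/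
theorem IsArensRegular.arensRight_arensLeft (h : IsArensRegular A) (F G : Bidual A)
    (f : StrongDual ℂ A) : arensRight (arensLeft G f) F = arensLeft G (arensRight f F) := by
  ext a
  -- Each bracketing is written in the product whose value at $f$ unfolds to the matching side
  -- below; regularity reduces their equality to associativity of $\square$.
  have key : F * ((inclusionInDoubleDual ℂ A a : Bidual A) * G) =
      secondArens (secondArens F (inclusionInDoubleDual ℂ A a)) G := by
    rw [← h, ← h, ← mul_assoc]; rfl
  have hl : (F * ((inclusionInDoubleDual ℂ A a : Bidual A) * G)) f =
      arensRight (arensLeft G f) F a := by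
    change F _ = F _
    congr 1
    ext b
    change G _ = G _
    congr 1
    ext c
    simp [mul_assoc]
  have hr : secondArens (secondArens F (inclusionInDoubleDual ℂ A a)) G f =
      arensLeft G (arensRight f F) a := by
    change G _ = G _
    congr 1
    ext c
    change F _ = F _
    congr 1
    ext b
    simp [mul_assoc]
  rw [← hl, ← hr, key]

/-- The dual `A*` of an Arens regular algebra `A` as a Banach `A**`-bimodule. -/
noncomputable def IsArensRegular.dualBimodule (h : IsArensRegular A) :
    BanachBimodule (Bidual A) (StrongDual ℂ A) where
  left := LinearMap.mkContinuous₂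
    (LinearMap.mk₂ ℂ arensLeft (fun _ _ _ => rfl) (fun _ _ _ => rfl)
      (fun G f g => by ext a; simp [arensLeft_apply, ContinuousLinearMap.add_comp])
      (fun c G f => by ext a; simp [arensLeft_apply, ContinuousLinearMap.smul_comp]))
    1 fun G f => by rw [one_mul]; exact norm_arensLeft_le G f
  right := LinearMap.mkContinuous₂
    (LinearMap.mk₂ ℂ (fun F f => arensRight f F) (fun _ _ _ => rfl) (fun _ _ _ => rfl)
      (fun F f g => by ext a; simp [arensRight_apply, ContinuousLinearMap.add_comp])
      (fun c F f => by ext a; simp [arensRight_apply, ContinuousLinearMap.smul_comp]))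
    1 fun F f => by rw [one_mul]; exact norm_arensRight_le f F
  left_mul F G f := arensLeft_mul F G f
  right_mul F G f := by
    change arensRight f (firstArens F G) = _
    rw [h]
    exact arensRight_secondArens F G f
  left_right G F f := h.arensRight_arensLeft F G f

/-- A weak* cluster point of a bounded approximate identity acts as a two-sided unit on `A*`. -/
theorem HasBoundedApproximateIdentity.exists_unit (h : HasBoundedApproximateIdentity A) :
    ∃ E : Bidual A, ∀ f : StrongDual ℂ A, arensLeft E f = f ∧ arensRight f E = f := by
  obtain ⟨l, hl, C, hC⟩ := h
  have := hl.neBot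
  -- Along an ultrafilter, weak* compactness of the ball gives a limit, so the same element serves
  -- on both sides.
  let U := Ultrafilter.of l
  have hU : (U : Filter A) ≤ l := Ultrafilter.of_le l
  let j : A → WeakDual ℂ (StrongDual ℂ A) := fun a =>
    StrongDual.toWeakDual (inclusionInDoubleDual ℂ A a)
  obtain ⟨w, -, hw⟩ := (WeakDual.isCompact_closedBall (0 : Bidual A) C).ultrafilter_le_nhds
    (U.map j) (by
      rw [Filter.le_principal_iff]
      change ∀ᶠ a in (U : Filter A), j a ∈ _
      filter_upwards [hU hC] with a ha
      simp only [Set.mem_preimage, mem_closedBall_zero_iff]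
      exact (double_dual_bound ℂ A a).trans ha)
  have hlim (f : StrongDual ℂ A) : Tendsto (fun a => f a) U (𝓝 (WeakDual.toStrongDual w f)) :=
    ((WeakDual.eval_continuous f).tendsto w).comp (show Tendsto j U (𝓝 w) from hw)
  refine ⟨WeakDual.toStrongDual w, fun f => ⟨?_, ?_⟩⟩ <;> ext a
  -- $(E \cdot f)(a) = E(f \cdot a) = \lim f(ae) = f(a)$; the other side uses $f(ea)$.
  · exact tendsto_nhds_unique (hlim _)
      ((f.continuous.tendsto a).comp ((hl.tendsto_mul_left a).mono_left hU))
  · exact tendsto_nhds_unique (hlim _)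
      ((f.continuous.tendsto a).comp ((hl.tendsto_mul_right a).mono_left hU))

theorem IsArensRegular.neoUnital_dualBimodule (h : IsArensRegular A)
    (hbai : HasBoundedApproximateIdentity A) : h.dualBimodule.NeoUnital := by
  obtain ⟨E, hE⟩ := hbai.exists_unit
  intro f
  refine ⟨E, E, f, ?_⟩
  change f = arensLeft E (arensRight f E)
  rw [(hE f).2, (hE f).1]

/-- Factorization in the dual of the `A**`-bimodule `A*` gives `A** = A · A**`, so `A` is
reflexive when it is a right ideal of `A**`. -/
theorem NeoUnitalDualsFactor.surjective_inclusionInDoubleDual (hfactor : NeoUnitalDualsFactor A)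
    (hreg : IsArensRegular A) (hbai : HasBoundedApproximateIdentity A)
    (hideal : IsRightIdealInBidual A) :
    Function.Surjective (inclusionInDoubleDual ℂ A) := by
  intro H
  obtain ⟨a, G, hG⟩ := hfactor _ hreg.dualBimodule (hreg.neoUnital_dualBimodule hbai) H
  obtain ⟨b, hb⟩ := hideal a G
  -- Both $(a \cdot G)(f)$ and $(a \,\square\, G)(f)$ unfold to $G(f \cdot a)$.
  exact ⟨b, by rw [← hb, hG]; rfl⟩

end BidualModule

/-! ### Connes amenability of the bidual of a reflexive algebra -/

section Reflexive

open NormedSpace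

/-- On the bidual of a reflexive space every bounded operator into a dual space is weak*-weak*
continuous. -/
theorem weakStarContinuous_of_surjective {A Y : Type u} [NonUnitalNormedRing A] [NormedSpace ℂ A]
    [IsScalarTower ℂ A A] [SMulCommClass ℂ A A] [NormedAddCommGroup Y] [NormedSpace ℂ Y]
    (hA : Function.Surjective (inclusionInDoubleDual ℂ A))
    (T : Bidual A →L[ℂ] StrongDual ℂ Y) :
    WeakStarContinuous (B := Bidual A) (P := StrongDual ℂ A)
      (LinearIsometryEquiv.refl ℂ (Bidual A)) T := by
  refine WeakDual.continuous_of_continuous_eval fun y => ?_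
  -- By reflexivity, $F \mapsto T(F)(y)$ is evaluation at its own restriction $g$ to $A$.
  let g : StrongDual ℂ A :=
    (inclusionInDoubleDual ℂ Y y).comp (T.comp (inclusionInDoubleDual ℂ A))
  convert WeakDual.eval_continuous (𝕜 := ℂ) g using 2 with w
  obtain ⟨a, ha⟩ := hA (WeakDual.toStrongDual w)
  change T (WeakDual.toStrongDual w) y = WeakDual.toStrongDual w g
  rw [← ha]
  rfl

namespace BanachBimodule

/-- Restriction of scalars along a bounded multiplicative map. -/
noncomputable def comap {A B X : Type u} [NonUnitalNormedRing A] [NormedSpace ℂ A]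
    [NonUnitalNormedRing B] [NormedSpace ℂ B] [NormedAddCommGroup X] [NormedSpace ℂ X]
    (M : BanachBimodule A X) (φ : B →L[ℂ] A) (hφ : ∀ a b, φ (a * b) = φ a * φ b) :
    BanachBimodule B X where
  left := M.left.comp φ
  right := M.right.comp φ
  left_mul a b x := by simp [hφ, M.left_mul]
  right_mul a b x := by simp [hφ, M.right_mul]
  left_right a b x := by simp [M.left_right]

end BanachBimodule

/-- For a reflexive algebra, Connes amenability of the bidual is amenability. -/
theorem IsConnesAmenable.isAmenable_of_surjective {A : Type u} [NonUnitalNormedRing A]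
    [NormedSpace ℂ A] [IsScalarTower ℂ A A] [SMulCommClass ℂ A A]
    (hconnes : IsConnesAmenable (B := Bidual A) (P := StrongDual ℂ A)
      (LinearIsometryEquiv.refl ℂ (Bidual A)))
    (hA : Function.Surjective (inclusionInDoubleDual ℂ A)) : IsAmenable A := by
  intro X _ _ _ M D hD
  let J : A ≃ₗᵢ[ℂ] Bidual A :=
    LinearIsometryEquiv.ofSurjective (inclusionInDoubleDualLi ℂ) hA
  have hJ (a b : A) : J (a * b) = J a * J b := inclusionInDoubleDual_mul a b
  let φ : Bidual A →L[ℂ] A := J.symm.toContinuousLinearEquiv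
  have hφJ (a : A) : φ (J a) = a := J.symm_apply_apply a
  have hφ (F G : Bidual A) : φ (F * G) = φ F * φ G := by
    obtain ⟨a, rfl⟩ := J.surjective F
    obtain ⟨b, rfl⟩ := J.surjective G
    rw [← hJ, hφJ, hφJ, hφJ]
  -- $X$ becomes an $A^{**}$-bimodule through $A^{**} \cong A$; normality of its dual is automatic.
  let N := M.comap (B := Bidual A) φ hφ
  obtain ⟨x, hx⟩ := hconnes X N
    (fun f => ⟨weakStarContinuous_of_surjective hA (N.dual.left.flip f),
      weakStarContinuous_of_surjective hA (N.dual.right.flip f)⟩)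
    (D.comp φ) (weakStarContinuous_of_surjective hA _)
    (fun F G => by
      change D (φ (F * G)) = M.dual.right (φ G) (D (φ F)) + M.dual.left (φ F) (D (φ G))
      rw [hφ, hD])
  refine ⟨x, fun a => ?_⟩
  have := hx (J a)
  change D (φ (J a)) = M.dual.left (φ (J a)) x - M.dual.right (φ (J a)) x at this
  rwa [hφJ] at this

end Reflexive

theorem theorem1p3 (A : Type u) [NonUnitalNormedRing A] [NormedSpace ℂ A]
    [IsScalarTower ℂ A A] [SMulCommClass ℂ A A] [CompleteSpace A]
    (hreg : IsArensRegular A)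
    (hbai : HasBoundedApproximateIdentity A)
    (hideal : IsRightIdealInBidual A)
    (hfactor : NeoUnitalDualsFactor A)
    (hconnes : IsConnesAmenable (B := Bidual A) (P := StrongDual ℂ A)
      (LinearIsometryEquiv.refl ℂ (Bidual A))) :
    IsAmenable A :=
  hconnes.isAmenable_of_surjective
    (hfactor.surjective_inclusionInDoubleDual hreg hbai hideal)
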